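/- Let $\mathcal{A}$ be a unital $C^*$-algebra and let $H_{\mathcal{A}}$ be the standard Hilbert $\mathcal{A}$-module, that is, the right $\mathcal{A}$-module of all sequences $(x_n)_{n\in\mathbb{N}}$ in $\mathcal{A}$ for which $\sum_n x_n^*x_n$ converges in norm, with $\langle x,y\rangle=\sum_n x_n^*y_n$ and $\|x\|=\|\langle x,x\rangle\|^{1/2}$. Let $B^a(H_{\mathcal{A}})$ be the algebra of bounded $\mathcal{A}$-linear adjointable operators on $H_{\mathcal{A}}$. Write $H_{\mathcal{A}}=M\,\tilde\oplus\,N$ if $M,N$ are closed submodules with $M\cap N=\{0\}$ and $M+N=H_{\mathcal{A}}$ (not necessarily orthogonal). For $T\in B^a(H_{\mathcal{A}})$: \begin{itemize} \item an $\mathcal{A}$-Fredholm decomposition for $T$ consists of two decompositions $H_{\mathcal{A}}=M_1\tilde\oplus N_1\xrightarrow{\;T\;}M_2\tilde\oplus N_2=H_{\mathcal{A}}$ such that $N_1$ and $N_2$ are finitely generated, $T$ restricts to an isomorphism from $M_1$ onto $M_2$, and $T(N_1)\subseteq N_2$; $T$ is $\mathcal{A}$-Fredholm if it has such a decomposition;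 \item $T$ is $\mathcal{A}$-Browder if it has an $\mathcal{A}$-Fredholm decomposition with $M_1=M_2$ and $N_1=N_2$; \item $T$ is Drazin invertible if there is some $p\in\mathbb{N}$ such that for all $k\ge p$ the image $\operatorname{Im}T^k$ is closed, $\operatorname{Im}T^k=\operatorname{Im}T^p$ and $\ker T^k=\ker T^p$; we then say that $p$ witnesses the Drazin invertibility of $T$. \end{itemize} Let $F,D\in B^a(H_{\mathcal{A}})$ with $FD=DF$. If $DF$ is Drazin invertible and $\mathcal{A}$-Fredholm, then $F$ and $D$ are both $\mathcal{A}$-Browder. More precisely, for every $p\in\mathbb{N}$ that witnesses the Drazin invertibility of $DF$, and with $M=\operatorname{Im}(FD)^p$ and $N=\ker(FD)^p$, the decomposition $H_{\mathcal{A}}=M\tilde\oplus N\longrightarrow M\tilde\oplus N=H_{\mathcal{A}}$ is an $\mathcal{A}$-Fredholm decomposition both for $F$ and for $D$ (in particular $N$ is finitely generated). -/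

import Mathlib

/-- In a C⋆-algebra, a family that is dominated by a summable family of positive elements, and is
itself positive, is summable (in norm). -/
theorem summable_of_nonneg_of_le_cstar {A : Type*} [CStarAlgebra A] [PartialOrder A]
    [StarOrderedRing A] {f g : ℕ → A} (hf : ∀ n, 0 ≤ f n) (hfg : ∀ n, f n ≤ g n)
    (hg : Summable g) : Summable f := by
  rw [summable_iff_vanishing_norm] at hg ⊢
  intro ε hε
  obtain ⟨s, hs⟩ := hg ε hε
  refine ⟨s, fun t ht => lt_of_le_of_lt ?_ (hs t ht)⟩
  exact CStarAlgebra.norm_le_norm_of_nonneg_of_le (Finset.sum_nonneg fun i _ => hf i)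
    (Finset.sum_le_sum fun i _ => hfg i)

theorem summable_star_mul_self_add {A : Type*} [CStarAlgebra A] {x y : ℕ → A}
    (hx : Summable fun n => star (x n) * x n) (hy : Summable fun n => star (y n) * y n) :
    Summable fun n => star (x n + y n) * (x n + y n) := by
  let _ := CStarAlgebra.spectralOrder A
  have := CStarAlgebra.spectralOrderedRing A
  refine summable_of_nonneg_of_le_cstar (fun n => star_mul_self_nonneg _) (fun n => ?_)
    ((hx.add hy).add (hx.add hy))
  have h := star_mul_self_nonneg (x n - y n)
  rw [← sub_nonneg]
  convert h using 1
  simp only [star_add, star_sub]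
  noncomm_ring

/-- The square-summable sequences in `A`: those `x` for which `∑ x_n^* x_n` converges in the norm
of `A`. They form a right `A`-submodule (a module over `Aᵐᵒᵖ`) of `A^ℕ`. (The terms are positive,
so that convergence of the series and unconditional convergence are the same.) -/
def squareSummable (A : Type*) [CStarAlgebra A] : Submodule Aᵐᵒᵖ (ℕ → A) where
  carrier := {x | Summable fun n => star (x n) * x n}
  add_mem' hx hy := summable_star_mul_self_add hx hy
  zero_mem' := by simp [summable_zero]
  smul_mem' a x hx := by
    have h := (Summable.mul_left (star a.unop) hx).mul_right a.unop
    refine h.congr fun n => ?_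
    simp [mul_assoc]

/-- The standard Hilbert module `H_A` over the unital C⋆-algebra `A`. -/
def HilbertStd (A : Type*) [CStarAlgebra A] : Type _ := squareSummable A

namespace HilbertStd

variable {A : Type*} [CStarAlgebra A]

noncomputable instance : AddCommGroup (HilbertStd A) :=
  inferInstanceAs (AddCommGroup (squareSummable A))

/-- The right `A`-module structure `(x · a)_n = x_n a`. -/
noncomputable instance : Module Aᵐᵒᵖ (HilbertStd A) :=
  inferInstanceAs (Module Aᵐᵒᵖ (squareSummable A))

/-- The sequence of coordinates of an element of `H_A`. -/
instance : CoeFun (HilbertStd A) (fun _ => ℕ → A) := ⟨fun x => x.1⟩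

theorem ext {x y : HilbertStd A} (h : ∀ n, x n = y n) : x = y := Subtype.ext (funext h)

theorem add_apply (x y : HilbertStd A) (n : ℕ) : (x + y) n = x n + y n := rfl

theorem op_smul_apply (a : Aᵐᵒᵖ) (x : HilbertStd A) (n : ℕ) : (a • x) n = x n * a.unop := rfl

/-- The complex vector space structure, through the scalar multiples of the unit of `A`. -/
noncomputable instance : Module ℂ (HilbertStd A) :=
  Module.compHom (HilbertStd A) (algebraMap ℂ Aᵐᵒᵖ)

theorem smul_apply (c : ℂ) (x : HilbertStd A) (n : ℕ) : (c • x) n = c • x n := by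
  change x n * (algebraMap ℂ Aᵐᵒᵖ c).unop = c • x n
  simp [Algebra.algebraMap_eq_smul_one]

theorem summable_self (x : HilbertStd A) : Summable fun n => star (x n) * x n := x.2

theorem summable_inner (x y : HilbertStd A) : Summable fun n => star (x n) * y n := by
  have h₁ := ((x + y).summable_self.sub x.summable_self).sub y.summable_self
  have h₂ := (((Complex.I • x + y).summable_self.sub x.summable_self).sub
    y.summable_self).const_smul Complex.I
  refine ((h₁.add h₂).const_smul (2⁻¹ : ℂ)).congr fun n => ?_
  simp only [add_apply, smul_apply, star_add, star_smul, add_mul, mul_add, smul_mul_assoc,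
    mul_smul_comm, smul_add, smul_sub, smul_smul, Complex.star_def, Complex.conj_I]
  match_scalars <;> ring_nf <;> simp only [Complex.I_sq, Complex.I_pow_three] <;> ring

/-- The `A`-valued inner product `⟨x, y⟩ = ∑ x_n^* y_n`, conjugate linear in `x` and `A`-linear
in `y`. -/
noncomputable def innerA (x y : HilbertStd A) : A := ∑' n, star (x n) * y n

/-- The Hilbert module norm `‖x‖ = ‖⟨x, x⟩‖ ^ (1/2)`. -/
noncomputable instance : Norm (HilbertStd A) := ⟨fun x => √‖innerA x x‖⟩

theorem norm_def (x : HilbertStd A) : ‖x‖ = √‖innerA x x‖ := rfl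

/-- `H_A` is a Hilbert C⋆-module in Mathlib's sense. As Mathlib's scalars act from the left, the
right module `H_A` over `A` is a module over the opposite algebra. -/
@[reducible]
noncomputable def cstarModule [PartialOrder Aᵐᵒᵖ] [StarOrderedRing Aᵐᵒᵖ] :
    CStarModule Aᵐᵒᵖ (HilbertStd A) where
  inner x y := MulOpposite.op (innerA x y)
  inner_add_right {x y z} := by
    rw [← MulOpposite.op_add]
    congr 1
    simp only [innerA, add_apply, mul_add]
    exact (x.summable_inner y).tsum_add (x.summable_inner z)
  inner_self_nonneg {x} := by
    rw [innerA, ← tsum_op]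
    exact tsum_nonneg fun n => by
      rw [MulOpposite.op_mul, MulOpposite.op_star]
      exact mul_star_self_nonneg _
  inner_self {x} := by
    constructor
    · intro h
      have hs : Summable fun n => MulOpposite.op (star (x n) * x n) := x.summable_self.op
      rw [innerA, ← tsum_op] at h
      have hnn : ∀ n, 0 ≤ MulOpposite.op (star (x n) * x n) := fun n => by
        rw [MulOpposite.op_mul, MulOpposite.op_star]
        exact mul_star_self_nonneg _
      refine ext fun n => ?_
      have h0 := le_antisymm ((hs.le_tsum n fun j _ => hnn j).trans_eq h) (hnn n)
      rw [MulOpposite.op_eq_zero_iff, CStarRing.star_mul_self_eq_zero_iff] at h0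
      exact h0
    · rintro rfl
      have : ∀ n, (0 : HilbertStd A) n = 0 := fun _ => rfl
      simp [innerA, this]
  inner_op_smul_right {a x y} := by
    rw [← MulOpposite.op_unop a, ← MulOpposite.op_mul]
    congr 1
    simp only [innerA, op_smul_apply, MulOpposite.unop_op, ← mul_assoc]
    exact (x.summable_inner y).tsum_mul_right _
  inner_smul_right_complex {z x y} := by
    rw [← MulOpposite.op_smul]
    congr 1
    simp only [innerA, smul_apply, mul_smul_comm]
    exact (x.summable_inner y).tsum_const_smul _
  star_inner x y := by
    rw [← MulOpposite.op_star]
    congr 1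
    rw [innerA, tsum_star]
    simp [innerA]
  norm_eq_sqrt_norm_inner_self x := rfl

theorem normedSpaceCore : NormedSpace.Core ℂ (HilbertStd A) := by
  let _ := CStarAlgebra.spectralOrder Aᵐᵒᵖ
  have := CStarAlgebra.spectralOrderedRing Aᵐᵒᵖ
  let _ : CStarModule Aᵐᵒᵖ (HilbertStd A) := cstarModule
  exact CStarModule.normedSpaceCore Aᵐᵒᵖ

noncomputable instance : NormedAddCommGroup (HilbertStd A) :=
  NormedAddCommGroup.ofCore normedSpaceCore

noncomputable instance : NormedSpace ℂ (HilbertStd A) := NormedSpace.ofCore normedSpaceCore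

/-- A bounded `A`-linear operator on `H_A` belongs to `B^a(H_A)` if it has an adjoint. -/
def IsAdjointable (F : HilbertStd A →L[Aᵐᵒᵖ] HilbertStd A) : Prop :=
  ∃ G : HilbertStd A →L[Aᵐᵒᵖ] HilbertStd A, ∀ x y, innerA (F x) y = innerA x (G y)

/-- With `p` as witness, `F` is Drazin invertible: for all `k ≥ p` the image of `F^k` is closed,
`Im F^k = Im F^p` and `ker F^k = ker F^p`. -/
def IsDrazinAt (F : HilbertStd A →L[Aᵐᵒᵖ] HilbertStd A) (p : ℕ) : Prop :=
  ∀ k, p ≤ k →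
    IsClosed ((F ^ k).range : Set (HilbertStd A)) ∧
    (F ^ k).range = (F ^ p).range ∧
    (F ^ k).ker = (F ^ p).ker

/-- Drazin invertibility. -/
def IsDrazinInvertible (F : HilbertStd A →L[Aᵐᵒᵖ] HilbertStd A) : Prop :=
  ∃ p : ℕ, IsDrazinAt F p

/-- `H_A = M ∔ N` for closed submodules `M` and `N` (not necessarily orthogonal). -/
structure IsDirectSum (M N : Submodule Aᵐᵒᵖ (HilbertStd A)) : Prop where
  isClosed_left : IsClosed (M : Set (HilbertStd A))
  isClosed_right : IsClosed (N : Set (HilbertStd A))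
  inf_eq_bot : M ⊓ N = ⊥
  sup_eq_top : M ⊔ N = ⊤

/-- `H_A = M₁ ∔ N₁ → M₂ ∔ N₂ = H_A` is an `A`-Fredholm decomposition for `F`: with respect to it,
`F` has a diagonal matrix, its part `M₁ → M₂` is an isomorphism, and `N₁`, `N₂` are finitely
generated. -/
structure IsFredholmDecomposition (F : HilbertStd A →L[Aᵐᵒᵖ] HilbertStd A)
    (M₁ N₁ M₂ N₂ : Submodule Aᵐᵒᵖ (HilbertStd A)) : Prop where
  directSum_source : IsDirectSum M₁ N₁
  directSum_target : IsDirectSum M₂ N₂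
  iso : ∃ F₁ : M₁ ≃L[Aᵐᵒᵖ] M₂, ∀ x : M₁, (F₁ x : HilbertStd A) = F x
  mapsTo : ∀ x ∈ N₁, F x ∈ N₂
  fg_source : N₁.FG
  fg_target : N₂.FG

/-- `A`-Fredholm operators. -/
def IsFredholm (F : HilbertStd A →L[Aᵐᵒᵖ] HilbertStd A) : Prop :=
  ∃ M₁ N₁ M₂ N₂, IsFredholmDecomposition F M₁ N₁ M₂ N₂

/-- `A`-Browder operators: there is an `A`-Fredholm decomposition with the same summands in the
source and in the target. -/
def IsBrowder (F : HilbertStd A →L[Aᵐᵒᵖ] HilbertStd A) : Prop :=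
  ∃ M N, IsFredholmDecomposition F M N M N

end HilbertStd

namespace HilbertStd

variable {A : Type*} [CStarAlgebra A]

/-! Put T = FD = DF. Stabilisation of the images and kernels of powers of T at p splits the module
as Im T^p ⊕ ker T^p (`IsDrazinAt.isDirectSum`). Both F and D commute with T, so they preserve the
summands. On Im T^p, DF = T is injective and FD = T is onto, so F is bijective there; by symmetry so
is D. Completeness and the open mapping theorem make the restrictions topological isomorphisms. The
Fredholm hypothesis is needed to show that ker T^p is finitely generated. Submodules do not inherit
finite generation, so `IsFredholm.exists_fg_ker_pow_le` only encloses the kernel in a finitely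
generated submodule; projecting that along Im T^p gives generators. -/

theorem sub_apply (x y : HilbertStd A) (n : ℕ) : (x - y) n = x n - y n := rfl

theorem norm_sq (x : HilbertStd A) : ‖x‖ ^ 2 = ‖innerA x x‖ := by
  rw [norm_def, Real.sq_sqrt (norm_nonneg _)]

/-- Partial sums of `∑ x_n^* x_n` are bounded in norm by `‖x‖ ^ 2`. -/
theorem norm_sum_le_norm_sq (x : HilbertStd A) (s : Finset ℕ) :
    ‖∑ n ∈ s, star (x n) * x n‖ ≤ ‖x‖ ^ 2 := by
  let _ := CStarAlgebra.spectralOrder A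
  have := CStarAlgebra.spectralOrderedRing A
  rw [norm_sq]
  exact CStarAlgebra.norm_le_norm_of_nonneg_of_le
    (Finset.sum_nonneg fun i _ => star_mul_self_nonneg _)
    (x.summable_self.sum_le_tsum s fun i _ => star_mul_self_nonneg _)

theorem norm_apply_le (x : HilbertStd A) (n : ℕ) : ‖x n‖ ≤ ‖x‖ := by
  have h := x.norm_sum_le_norm_sq {n}
  rw [Finset.sum_singleton, CStarRing.norm_star_mul_self, ← sq] at h
  exact le_of_sq_le_sq h (norm_nonneg _)

/-- If all partial sums of `∑ x_n^* x_n` are bounded in norm by `c ^ 2`, then `‖x‖ ≤ c`. -/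
theorem norm_le_of_norm_sum_le (x : HilbertStd A) {c : ℝ} (hc : 0 ≤ c)
    (h : ∀ s : Finset ℕ, ‖∑ n ∈ s, star (x n) * x n‖ ≤ c ^ 2) : ‖x‖ ≤ c := by
  refine le_of_sq_le_sq ?_ hc
  rw [norm_sq]
  exact le_of_tendsto x.summable_self.hasSum.norm (Filter.Eventually.of_forall h)

/-- With d = x - y, 2d*d + 2x*x - y*y = (x + d)*(x + d) ≥ 0 termwise. -/
theorem norm_sum_star_mul_self_le (s : Finset ℕ) (x y : ℕ → A) :
    ‖∑ n ∈ s, star (y n) * y n‖ ≤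
      2 * ‖∑ n ∈ s, star (x n - y n) * (x n - y n)‖ + 2 * ‖∑ n ∈ s, star (x n) * x n‖ := by
  let _ := CStarAlgebra.spectralOrder A
  have := CStarAlgebra.spectralOrderedRing A
  have hle : ∑ n ∈ s, star (y n) * y n ≤
      (∑ n ∈ s, star (x n - y n) * (x n - y n) + ∑ n ∈ s, star (x n - y n) * (x n - y n)) +
        (∑ n ∈ s, star (x n) * x n + ∑ n ∈ s, star (x n) * x n) := by
    simp only [← Finset.sum_add_distrib]
    refine Finset.sum_le_sum fun n _ => ?_
    have h := star_mul_self_nonneg (x n + (x n - y n))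
    rw [← sub_nonneg]
    convert h using 1
    simp only [star_add, star_sub]
    noncomm_ring
  refine (CStarAlgebra.norm_le_norm_of_nonneg_of_le
    (Finset.sum_nonneg fun i _ => star_mul_self_nonneg _) hle).trans ?_
  refine (norm_add_le _ _).trans (add_le_add ?_ ?_) <;>
    exact (norm_add_le _ _).trans_eq (two_mul _).symm

/-- Coordinatewise limits work because the Cauchy estimate passes to the limit on each finite set of
indices, uniformly in that set. -/
instance : CompleteSpace (HilbertStd A) := by
  refine Metric.complete_of_cauchySeq_tendsto fun u hu => ?_
  have hcoord (n : ℕ) : CauchySeq fun k => u k n := by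
    rw [Metric.cauchySeq_iff] at hu ⊢
    intro ε hε
    obtain ⟨K, hK⟩ := hu ε hε
    refine ⟨K, fun k hk l hl => lt_of_le_of_lt ?_ (hK k hk l hl)⟩
    rw [dist_eq_norm, dist_eq_norm, ← sub_apply]
    exact norm_apply_le _ n
  choose y hy using fun n => cauchySeq_tendsto_of_complete (hcoord n)
  have hclose (ε : ℝ) (hε : 0 < ε) : ∃ K, ∀ k, K ≤ k → ∀ s : Finset ℕ,
      ‖∑ n ∈ s, star (u k n - y n) * (u k n - y n)‖ ≤ ε ^ 2 := by
    obtain ⟨K, hK⟩ := Metric.cauchySeq_iff.1 hu ε hε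
    refine ⟨K, fun k hk s => ?_⟩
    have hlim : Filter.Tendsto
        (fun l => ‖∑ n ∈ s, star (u k n - u l n) * (u k n - u l n)‖) Filter.atTop
        (nhds ‖∑ n ∈ s, star (u k n - y n) * (u k n - y n)‖) :=
      (tendsto_finsetSum s fun n _ =>
        ((tendsto_const_nhds.sub (hy n)).star.mul (tendsto_const_nhds.sub (hy n)))).norm
    refine le_of_tendsto hlim (Filter.eventually_atTop.2 ⟨K, fun l hl => ?_⟩)
    refine ((u k - u l).norm_sum_le_norm_sq s).trans ?_
    have := hK k hk l hl
    rw [dist_eq_norm] at this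
    gcongr
  have hmem : Summable fun n => star (y n) * y n := by
    rw [summable_iff_vanishing_norm]
    intro ε hε
    -- The two bounds ε/8, each doubled by `norm_sum_star_mul_self_le`, total ε/2.
    obtain ⟨K, hK⟩ := hclose (√(ε / 8)) (by positivity)
    obtain ⟨s, hs⟩ := summable_iff_vanishing_norm.1 (u K).summable_self (ε / 8) (by positivity)
    refine ⟨s, fun t ht => ?_⟩
    have h₁ := hK K le_rfl t
    rw [Real.sq_sqrt (by positivity)] at h₁
    have h₂ := norm_sum_star_mul_self_le t (u K) y
    linarith [hs t ht]
  let z : HilbertStd A := show squareSummable A from ⟨y, hmem⟩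
  refine ⟨z, Metric.tendsto_atTop.2 fun ε hε => ?_⟩
  obtain ⟨K, hK⟩ := hclose (ε / 2) (by positivity)
  refine ⟨K, fun k hk => ?_⟩
  rw [dist_eq_norm]
  exact (norm_le_of_norm_sum_le (u k - z) (by positivity) fun s => hK k hk s).trans_lt (by linarith)

/-! ### Topological isomorphisms from bijective restrictions -/

instance : IsScalarTower ℂ Aᵐᵒᵖ (HilbertStd A) where
  smul_assoc c a x := by
    refine ext fun n => ?_
    simp [smul_apply, op_smul_apply]

/-- A bounded operator that maps a closed submodule bijectively onto a closed submodule restricts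
to a topological isomorphism. -/
theorem exists_continuousLinearEquiv_of_bijOn (F : HilbertStd A →L[Aᵐᵒᵖ] HilbertStd A)
    {M₁ M₂ : Submodule Aᵐᵒᵖ (HilbertStd A)} (h₁ : IsClosed (M₁ : Set (HilbertStd A)))
    (h₂ : IsClosed (M₂ : Set (HilbertStd A))) (h : Set.BijOn F M₁ M₂) :
    ∃ F₁ : M₁ ≃L[Aᵐᵒᵖ] M₂, ∀ x : M₁, (F₁ x : HilbertStd A) = F x := by
  have : CompleteSpace M₁ := h₁.completeSpace_coe
  have : CompleteSpace M₂ := h₂.completeSpace_coe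
  let f : M₁ →L[Aᵐᵒᵖ] M₂ := F.restrict h.mapsTo
  let e : M₁ ≃ₗ[Aᵐᵒᵖ] M₂ := LinearEquiv.ofBijective f.toLinearMap h.bijective
  have he : Continuous e := f.continuous
  -- The open mapping theorem is applied over the field ℂ.
  exact ⟨⟨e, he, (e.restrictScalars ℂ).continuous_symm he⟩, fun x => rfl⟩

/-! ### Finite generation of kernels -/

/-- The preimage of a finitely generated submodule under a Fredholm operator is contained in a
finitely generated submodule. -/
theorem IsFredholm.exists_fg_comap_le {T : HilbertStd A →L[Aᵐᵒᵖ] HilbertStd A}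
    (hT : IsFredholm T) {L : Submodule Aᵐᵒᵖ (HilbertStd A)} (hL : L.FG) :
    ∃ L' : Submodule Aᵐᵒᵖ (HilbertStd A), L'.FG ∧ L.comap T.toLinearMap ≤ L' := by
  obtain ⟨M₁, N₁, M₂, N₂, h⟩ := hT
  obtain ⟨T₁, hT₁⟩ := h.iso
  have hc : IsCompl M₂ N₂ :=
    ⟨disjoint_iff.2 h.directSum_target.inf_eq_bot, codisjoint_iff.2 h.directSum_target.sup_eq_top⟩
  -- `g` recovers the M₁-component of x from T x: projecting along N₂ removes the contribution of
  -- N₁.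
  let g : HilbertStd A →ₗ[Aᵐᵒᵖ] HilbertStd A :=
    M₁.subtype ∘ₗ T₁.symm.toLinearEquiv.toLinearMap ∘ₗ M₂.projectionOnto N₂ hc
  refine ⟨L.map g ⊔ N₁, (hL.map g).sup h.fg_source, fun x hx => ?_⟩
  obtain ⟨m, hm, n, hn, rfl⟩ :=
    Submodule.mem_sup.1 (h.directSum_source.sup_eq_top ▸ Submodule.mem_top : x ∈ M₁ ⊔ N₁)
  refine Submodule.add_mem_sup ⟨T (m + n), hx, ?_⟩ hn
  have h₁ : M₂.projectionOnto N₂ hc (T m) = T₁ ⟨m, hm⟩ := by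
    rw [← hT₁ ⟨m, hm⟩, Submodule.projectionOnto_apply_left]
  have h₂ : M₂.projectionOnto N₂ hc (T n) = 0 :=
    (Submodule.projectionOnto_apply_eq_zero_iff hc).2 (h.mapsTo n hn)
  simp [g, h₁, h₂]

/-- The kernel of a power of a Fredholm operator is contained in a finitely generated
submodule. -/
theorem IsFredholm.exists_fg_ker_pow_le {T : HilbertStd A →L[Aᵐᵒᵖ] HilbertStd A}
    (hT : IsFredholm T) (k : ℕ) :
    ∃ L : Submodule Aᵐᵒᵖ (HilbertStd A), L.FG ∧ (T ^ k).ker ≤ L := by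
  induction k with
  | zero => exact ⟨⊥, Submodule.fg_bot, fun x hx => by simpa using hx⟩
  | succ k ih =>
    obtain ⟨L, hL, hkL⟩ := ih
    obtain ⟨L', hL', hLL'⟩ := hT.exists_fg_comap_le hL
    refine ⟨L', hL', fun x hx => hLL' (hkL ?_)⟩
    rw [pow_succ] at hx
    exact hx

/-- A complemented submodule of a finitely generated submodule is finitely generated. -/
theorem fg_of_le_of_isCompl {R E : Type*} [Ring R] [AddCommGroup E] [Module R E]
    {M N L : Submodule R E} (hc : IsCompl N M) (hL : L.FG) (hNL : N ≤ L) : N.FG := by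
  have : N = L.map (N.subtype ∘ₗ N.projectionOnto M hc) := by
    apply le_antisymm
    · refine fun x hx => ⟨x, hNL hx, ?_⟩
      simpa using congrArg Subtype.val (Submodule.projectionOnto_apply_left hc ⟨x, hx⟩)
    · rintro _ ⟨x, -, rfl⟩
      exact (N.projectionOnto M hc x).2
  rw [this]
  exact hL.map _

/-! ### The splitting by image and kernel -/

namespace IsDrazinAt

variable {T : HilbertStd A →L[Aᵐᵒᵖ] HilbertStd A} {p : ℕ}

theorem isDirectSum (h : IsDrazinAt T p) : IsDirectSum (T ^ p).range (T ^ p).ker where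
  isClosed_left := (h p le_rfl).1
  isClosed_right := (T ^ p).isClosed_ker
  inf_eq_bot := by
    refine (Submodule.eq_bot_iff _).2 ?_
    rintro _ ⟨⟨y, rfl⟩, hy⟩
    have : y ∈ (T ^ (p + p)).ker := by rw [pow_add]; exact hy
    rwa [(h (p + p) (by omega)).2.2] at this
  sup_eq_top := by
    refine eq_top_iff.2 fun x _ => ?_
    -- Writing T^p x = T^(2p) y makes x - T^p y a kernel element.
    have hx : (T ^ p) x ∈ (T ^ (p + p)).range := by
      rw [(h (p + p) (by omega)).2.1]
      exact ⟨x, rfl⟩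
    obtain ⟨y, hy⟩ := hx
    rw [pow_add] at hy
    refine Submodule.mem_sup.2 ⟨(T ^ p) y, ⟨y, rfl⟩, x - (T ^ p) y, ?_, add_sub_cancel _ _⟩
    change (T ^ p) (x - (T ^ p) y) = 0
    rw [map_sub, sub_eq_zero]
    exact hy.symm

/-- If `T` is Drazin invertible and Fredholm, then each factor of a commuting factorization of `T`
has the Fredholm decomposition given by the range and the kernel of `T ^ p`. -/
theorem isFredholmDecomposition_of_mul_eq (h : IsDrazinAt T p) (hT : IsFredholm T)
    {F D : HilbertStd A →L[Aᵐᵒᵖ] HilbertStd A} (hFD : F * D = T) (hDF : D * F = T) :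
    IsFredholmDecomposition F (T ^ p).range (T ^ p).ker (T ^ p).range (T ^ p).ker := by
  have hds := h.isDirectSum
  have hfg : (T ^ p).ker.FG := by
    obtain ⟨L, hL, hle⟩ := hT.exists_fg_ker_pow_le p
    exact fg_of_le_of_isCompl
      (IsCompl.symm ⟨disjoint_iff.2 hds.inf_eq_bot, codisjoint_iff.2 hds.sup_eq_top⟩) hL hle
  have hF : Commute F T := by
    rw [commute_iff_eq, ← hFD, mul_assoc, hDF, ← hFD]
  have hD : Commute D T := by
    rw [commute_iff_eq, ← hDF, mul_assoc, hFD, ← hDF]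
  have hFp (x) : F ((T ^ p) x) = (T ^ p) (F x) := DFunLike.congr_fun (hF.pow_right p).eq x
  have hDp (x) : D ((T ^ p) x) = (T ^ p) (D x) := DFunLike.congr_fun (hD.pow_right p).eq x
  have hTp (x) : T ((T ^ p) x) = (T ^ (p + 1)) x := by rw [pow_succ']; rfl
  refine ⟨hds, hds, exists_continuousLinearEquiv_of_bijOn F hds.isClosed_left hds.isClosed_left
    ⟨?_, ?_, ?_⟩, fun x hx => ?_, hfg, hfg⟩
  · rintro _ ⟨y, rfl⟩
    exact ⟨F y, (hFp y).symm⟩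
  · rintro _ ⟨x, rfl⟩ _ ⟨y, rfl⟩ hxy
    have h₁ : (T ^ (p + 1)) x = (T ^ (p + 1)) y := by
      have hDFx (x) : D (F x) = T x := DFunLike.congr_fun hDF x
      rw [← hTp, ← hTp, ← hDFx, ← hDFx]
      exact congrArg D hxy
    have h₂ : x - y ∈ (T ^ (p + 1)).ker := by
      change (T ^ (p + 1)) (x - y) = 0
      rw [map_sub, h₁, sub_self]
    rw [(h (p + 1) (by omega)).2.2] at h₂
    have h₃ : (T ^ p) (x - y) = 0 := h₂
    rw [map_sub, sub_eq_zero] at h₃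
    exact h₃
  · intro x hx
    have hx' : x ∈ (T ^ (p + 1)).range := by
      rw [(h (p + 1) (by omega)).2.1]
      exact hx
    obtain ⟨y, rfl⟩ := hx'
    -- T^(p+1) y = FD T^p y = F(T^p D y).
    refine ⟨(T ^ p) (D y), ⟨D y, rfl⟩, ?_⟩
    rw [← hDp]
    change (F * D) ((T ^ p) y) = (T ^ (p + 1)) y
    rw [hFD, hTp]
  · change (T ^ p) (F x) = 0
    have hx' : (T ^ p) x = 0 := hx
    rw [← hFp, hx', map_zero]

end IsDrazinAt

end HilbertStd

theorem mainTheorem8 {A : Type*} [CStarAlgebra A]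
    (F D : HilbertStd A →L[Aᵐᵒᵖ] HilbertStd A)
    (hF : HilbertStd.IsAdjointable F) (hD : HilbertStd.IsAdjointable D)
    (hcomm : F * D = D * F)
    (hDrazin : HilbertStd.IsDrazinInvertible (D * F))
    (hFredholm : HilbertStd.IsFredholm (D * F)) :
    HilbertStd.IsBrowder F ∧ HilbertStd.IsBrowder D ∧
    ∀ p : ℕ, HilbertStd.IsDrazinAt (D * F) p →
      HilbertStd.IsFredholmDecomposition F
        ((F * D) ^ p).range ((F * D) ^ p).ker ((F * D) ^ p).range ((F * D) ^ p).ker ∧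
      HilbertStd.IsFredholmDecomposition D
        ((F * D) ^ p).range ((F * D) ^ p).ker ((F * D) ^ p).range ((F * D) ^ p).ker := by
  have key (p : ℕ) (hp : HilbertStd.IsDrazinAt (D * F) p) :
      HilbertStd.IsFredholmDecomposition F
        ((F * D) ^ p).range ((F * D) ^ p).ker ((F * D) ^ p).range ((F * D) ^ p).ker ∧
      HilbertStd.IsFredholmDecomposition D
        ((F * D) ^ p).range ((F * D) ^ p).ker ((F * D) ^ p).range ((F * D) ^ p).ker := by
    rw [hcomm]
    exact ⟨hp.isFredholmDecomposition_of_mul_eq hFredholm hcomm rfl,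
      hp.isFredholmDecomposition_of_mul_eq hFredholm rfl hcomm⟩
  obtain ⟨p, hp⟩ := hDrazin
  exact ⟨⟨_, _, (key p hp).1⟩, ⟨_, _, (key p hp).2⟩, key⟩
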